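/- All graphs are finite. For a connected graph $\Gamma$ write $d$ for its distance function, $\Gamma_i(x)$ for the set of vertices at distance $i$ from $x$, and $d(x,T)=\min_{y\in T} d(x,y)$ for a nonempty vertex set $T$. A connected graph $\Gamma$ of diameter $D$ is distance-regular if there are integers $b_i,c_i$ $(0\le i\le D)$ such that, whenever $d(x,y)=i$, exactly $c_i$ neighbours of $y$ lie in $\Gamma_{i-1}(x)$ and exactly $b_i$ lie in $\Gamma_{i+1}(x)$; its valency is $k=b_0$. Let $\theta_{\min}$ be the smallest eigenvalue of its adjacency matrix. A Delsarte clique is a clique with $1+\frac{k}{-\theta_{\min}}$ vertices. $\Gamma$ is geometric with respect to a set $\mathcal C$ of Delsarte cliques (called lines) if every edge of $\Gamma$ lies in exactly one member of $\mathcal C$. In that case let $\phi_j$ be the number of vertices at distance $j$ from $x$ in a Delsarte clique $C$ with $d(x,C)=j$, and let $\tau_j$ be the number of lines through $x$ at distance $j-1$ from $y$, where $d(x,y)=j$; these numbers depend only on $j$. For $d(x,y)=2$ let $[x,y]$ be the set of lines $\ell$ containing $x$ with $d(y,\ell)=1$. $\Gamma$ has the equal line set (ELS) property if, for every vertex $x$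 and every line $\ell$ with $d(x,\ell)=1$, and for all distinct $y_1,y_2\in\ell$ at distance $2$ from $x$, we have $[x,y_1]=[x,y_2]$. For integers $v\ge k'\ge t\ge 0$ and $\lambda\ge 1$, a $t$-$(v,k',\lambda)$-design is a pair $(\mathcal P,\mathcal B)$ in which $\mathcal P$ is a set of $v$ elements and $\mathcal B$ is a set of $k'$-subsets of $\mathcal P$ such that each $t$-subset of $\mathcal P$ lies in exactly $\lambda$ members of $\mathcal B$. **Theorem.** Let $\Gamma$ be a geometric distance-regular graph with respect to $\mathcal C$, with smallest eigenvalue $\theta_{\min}$, diameter $D\ge 3$ and $\phi_1\ge 2$, that has the ELS property. Then the numbers $\phi_1$, $\phi_2$ and $\tau_2$ are well defined (they do not depend on the choice of the clique and the vertices), $r=-\theta_{\min}$ is an integer, and the following hold. 1. For each vertex $x$, let $\mathcal L$ be the set of lines through $x$ and $\mathcal B=\{[x,z] : z\in\Gamma_2(x)\}$. Then $(\mathcal L,\mathcal B)$ is a $2$-$(r,\tau_2,1)$-design. 2. $r\ge \tau_2(\tau_2-1)+1$. 3. $\phi_2\ge \tau_2(\phi_1-1)+1$. -/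

import Mathlib

namespace GeomDRG

/-- `G` is distance-regular: it is connected and there are numbers `c i`, `b i` such that, whenever
`d(x, y) = i`, exactly `c i` neighbours of `y` are at distance `i - 1` from `x` and exactly `b i`
neighbours of `y` are at distance `i + 1` from `x`. -/
def IsDistanceRegular {V : Type*} (G : SimpleGraph V) : Prop :=
  G.Connected ∧ ∃ b c : ℕ → ℕ, ∀ (i : ℕ) (x y : V), G.dist x y = i →
    {z : V | G.Adj y z ∧ G.dist x z + 1 = i}.ncard = c i ∧
    {z : V | G.Adj y z ∧ G.dist x z = i + 1}.ncard = b i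

open Classical in
/-- The smallest eigenvalue `θ_min` of the adjacency matrix of a (nonempty) finite graph. -/
noncomputable def minEigenvalue {V : Type*} [Fintype V] (G : SimpleGraph V) : ℝ :=
  sInf {θ : ℝ | Module.End.HasEigenvalue (Matrix.mulVecLin (G.adjMatrix ℝ)) θ}

/-- A Delsarte clique of a `k`-regular graph: a clique with `1 + k / (-θ_min)` vertices. -/
def IsDelsarteClique {V : Type*} [Fintype V] (G : SimpleGraph V) (C : Set V) : Prop :=
  G.IsClique C ∧ ∃ k : ℕ, (∀ x : V, (G.neighborSet x).ncard = k) ∧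
    (C.ncard : ℝ) = 1 + (k : ℝ) / (-minEigenvalue G)

/-- `G` is a geometric distance-regular graph with respect to the set `𝒞` of Delsarte cliques
(the lines): every edge of `G` lies in exactly one member of `𝒞`. -/
def IsGeometric {V : Type*} [Fintype V] (G : SimpleGraph V) (𝒞 : Set (Set V)) : Prop :=
  IsDistanceRegular G ∧ (∀ C ∈ 𝒞, IsDelsarteClique G C) ∧
    ∀ x y : V, G.Adj x y → ∃! C : Set V, C ∈ 𝒞 ∧ x ∈ C ∧ y ∈ C

/-- The distance `d(x, T) = min {d(x, y) | y ∈ T}` from a vertex to a (nonempty) vertex set. -/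
noncomputable def distToSet {V : Type*} (G : SimpleGraph V) (x : V) (T : Set V) : ℕ :=
  sInf ((fun y => G.dist x y) '' T)

/-- The values, over all pairs of a Delsarte clique `C` and a vertex `x` with `d(x, C) = j`, of
the number of vertices of `C` at distance `j` from `x`. -/
def phiValues {V : Type*} [Fintype V] (G : SimpleGraph V) (j : ℕ) : Set ℕ :=
  {n | ∃ (C : Set V) (x : V), IsDelsarteClique G C ∧ distToSet G x C = j ∧
    n = {y ∈ C | G.dist x y = j}.ncard}

/-- The geometric parameter `φ_j`: the common value of the numbers in `phiValues G j`. -/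
noncomputable def phi {V : Type*} [Fintype V] (G : SimpleGraph V) (j : ℕ) : ℕ :=
  sInf (phiValues G j)

/-- The values, over all pairs of vertices `x`, `y` with `d(x, y) = j`, of the number of lines
containing `x` that are at distance `j - 1` from `y`. -/
def tauValues {V : Type*} (G : SimpleGraph V) (𝒞 : Set (Set V)) (j : ℕ) : Set ℕ :=
  {n | ∃ x y : V, G.dist x y = j ∧ n = {ℓ ∈ 𝒞 | x ∈ ℓ ∧ distToSet G y ℓ + 1 = j}.ncard}

/-- The geometric parameter `τ_j`: the common value of the numbers in `tauValues G 𝒞 j`. -/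
noncomputable def tau {V : Type*} (G : SimpleGraph V) (𝒞 : Set (Set V)) (j : ℕ) : ℕ :=
  sInf (tauValues G 𝒞 j)

/-- The set `[x, y]` of the lines containing `x` at distance `1` from `y`. -/
def lineSet {V : Type*} (G : SimpleGraph V) (𝒞 : Set (Set V)) (x y : V) : Set (Set V) :=
  {ℓ ∈ 𝒞 | x ∈ ℓ ∧ distToSet G y ℓ = 1}

/-- The equal line set (ELS) property. -/
def HasELS {V : Type*} (G : SimpleGraph V) (𝒞 : Set (Set V)) : Prop :=
  ∀ (x : V), ∀ ℓ ∈ 𝒞, distToSet G x ℓ = 1 →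
    ∀ y₁ ∈ ℓ, ∀ y₂ ∈ ℓ, y₁ ≠ y₂ → G.dist x y₁ = 2 → G.dist x y₂ = 2 →
      lineSet G 𝒞 x y₁ = lineSet G 𝒞 x y₂

/-- `(P, B)` is a `t`-`(v, k, lam)`-design: `v ≥ k ≥ t ≥ 0`, `lam ≥ 1`, `P` is a set of `v`
elements, `B` is a set of `k`-subsets of `P`, and every `t`-subset of `P` lies in exactly `lam`
members of `B`. -/
def IsDesign {α : Type*} (t v k lam : ℕ) (P : Set α) (B : Set (Set α)) : Prop :=
  t ≤ k ∧ k ≤ v ∧ 1 ≤ lam ∧ P.Finite ∧ P.ncard = v ∧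
    (∀ b ∈ B, b ⊆ P ∧ b.ncard = k) ∧
    ∀ T : Set α, T ⊆ P → T.ncard = t → {b ∈ B | T ⊆ b}.ncard = lam

end GeomDRG

/-!
Some polynomial in the adjacency matrix is a nonzero multiple of the projection onto the
eigenspace of `θ_min`, and by distance-regularity its entries depend only on the distance. It
annihilates the characteristic vector of a Delsarte clique, because a Delsarte clique attains
equality in Delsarte's bound. Reading off the row of a vertex `x` gives one linear equation for the
number of vertices of the clique nearest to `x`, so `φ_j` is well defined. Then `c₂ = τ₂ φ₁` shows
that `τ₂` is well defined too.

The blocks `[x, z]` form a design as soon as two lines through `x` determine `[x, z]`. For this,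
move along one of the two lines from `x` to a vertex `x'` at distance `2` from `z`: the ELS
property shows that `[x', z]` is determined by the two lines and `x'`, and the same argument leads
back from `x'` to `x`.

Both inequalities count a sunflower. Let `x, u, y` satisfy `d(x, u) = 2`, `d(u, y) = 1` and
`d(x, y) = 3`, and let `C` be the line through `u` and `y`. It is not in `[u, x]`, so the blocks
through `C` and a line of `[u, x]` give `τ₂ (τ₂ - 1) + 1` lines through `u`. For the second
inequality choose a common neighbour of `x` and `u` on each line of `[x, u]`; the neighbours on `C`
of these `τ₂` vertices are sets of size `φ₁` that meet pairwise in `u` only.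
-/

namespace GeomDRG

section Distance

variable {V : Type*} {G : SimpleGraph V} {x y z : V} {C T : Set V} {i : ℕ}

theorem dist_le_dist_add_one_of_adj (h : G.Adj y z) : G.dist x z ≤ G.dist x y + 1 := by
  have := h.diff_dist_adj (u := x)
  omega

theorem dist_eq_two_iff :
    G.dist x y = 2 ↔ x ≠ y ∧ ¬ G.Adj x y ∧ (G.commonNeighbors x y).Nonempty := by
  rw [← SimpleGraph.edist_eq_two_iff, SimpleGraph.dist, ENat.toNat_eq_iff two_ne_zero,
    Nat.cast_ofNat]

theorem exists_adj_dist_eq (h : G.dist x y = i + 1) : ∃ z, G.Adj z y ∧ G.dist x z = i := by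
  obtain ⟨p, hp⟩ := (SimpleGraph.Reachable.of_dist_ne_zero
    (h.trans_ne i.succ_ne_zero)).symm.exists_walk_length_eq_dist
  rw [G.dist_comm, h] at hp
  cases p with
  | nil => simp at hp
  | @cons _ z _ hyz q =>
    have hle : G.dist z x ≤ q.length := G.dist_le q
    have hge := dist_le_dist_add_one_of_adj (x := x) hyz.symm
    rw [SimpleGraph.Walk.length_cons] at hp
    rw [G.dist_comm] at hle
    exact ⟨z, hyz.symm, by omega⟩

theorem exists_dist_eq_of_le (h : i ≤ G.dist x y) : ∃ z, G.dist x z = i := by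
  induction h using Nat.decreasingInduction with
  | self => exact ⟨y, rfl⟩
  | of_succ j _ ih =>
    obtain ⟨z, hz⟩ := ih
    obtain ⟨w, -, hw⟩ := exists_adj_dist_eq hz
    exact ⟨w, hw⟩

theorem dist_le_dist_add_one_of_mem_clique (hC : G.IsClique C) (hy : y ∈ C) (hz : z ∈ C) :
    G.dist x z ≤ G.dist x y + 1 := by
  rcases eq_or_ne y z with rfl | hyz
  · exact Nat.le_succ _
  · exact dist_le_dist_add_one_of_adj (hC hy hz hyz)

theorem dist_eq_two_of_mem_clique (hC : G.IsClique C) (hx : x ∉ C) (hy : y ∈ C) (hz : z ∈ C)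
    (hxy : G.Adj x y) (hxz : ¬ G.Adj x z) : G.dist x z = 2 :=
  dist_eq_two_iff.2 ⟨fun e => hx (e ▸ hz), hxz, y, hxy, hC hz hy fun e => hxz (e ▸ hxy)⟩

theorem not_adj_of_two_lt_dist (hxy : 2 < G.dist x y) (hxz : G.Adj x z) :
    ¬ G.Adj z y := fun hzy => by
  have := dist_le_dist_add_one_of_adj (x := x) hzy
  rw [G.dist_eq_one_iff_adj.2 hxz] at this
  omega

theorem not_adj_of_mem_clique (hC : G.IsClique C) (hy : y ∈ C) (hz : z ∈ C)
    (hxy : 2 < G.dist x y) : ¬ G.Adj x z := fun hxz => by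
  have := dist_le_dist_add_one_of_mem_clique (x := x) hC hz hy
  rw [G.dist_eq_one_iff_adj.2 hxz] at this
  omega

theorem distToSet_le (hy : y ∈ T) : distToSet G x T ≤ G.dist x y :=
  Nat.sInf_le ⟨y, hy, rfl⟩

theorem exists_dist_eq_distToSet (x : V) (hT : T.Nonempty) :
    ∃ y ∈ T, G.dist x y = distToSet G x T :=
  Nat.sInf_mem (hT.image (G.dist x))

theorem distToSet_eq_dist (hy : y ∈ T) (hT : ∀ z ∈ T, G.dist x y ≤ G.dist x z) :
    distToSet G x T = G.dist x y := by
  obtain ⟨z, hz, hxz⟩ := exists_dist_eq_distToSet (G := G) x ⟨y, hy⟩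
  exact (distToSet_le hy).antisymm (hxz ▸ hT z hz)

theorem distToSet_clique_eq (hC : G.IsClique C) (hy : y ∈ C) (hz : z ∈ C) (hxy : G.dist x y = i)
    (hxz : G.dist x z = i + 1) : distToSet G x C = i := by
  refine (distToSet_eq_dist hy fun w hw => ?_).trans hxy
  have := dist_le_dist_add_one_of_mem_clique (x := x) hC hw hz
  omega

theorem distToSet_clique_eq_one_iff (hC : G.IsClique C) (hx : x ∉ C) :
    distToSet G x C = 1 ↔ ∃ y ∈ C, G.Adj x y := by
  constructor
  · intro h
    have hne : C.Nonempty := by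
      rw [Set.nonempty_iff_ne_empty]
      rintro rfl
      simp [distToSet] at h
    obtain ⟨y, hy, hxy⟩ := exists_dist_eq_distToSet (G := G) x hne
    exact ⟨y, hy, G.dist_eq_one_iff_adj.1 (hxy.trans h)⟩
  · rintro ⟨y, hy, hxy⟩
    rw [distToSet_eq_dist hy fun z hz => ?_, G.dist_eq_one_iff_adj.2 hxy]
    have hyz : G.Reachable y z := by
      rcases eq_or_ne y z with rfl | hyz
      · exact .rfl
      · exact (hC hy hz hyz).reachable
    rw [G.dist_eq_one_iff_adj.2 hxy]
    exact (hxy.reachable.trans hyz).pos_dist_of_ne fun hxz => hx (hxz ▸ hz)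

theorem ncard_adj_add_ncard_adj_le (hxy : 2 < G.dist x y) (hC : C.Finite) :
    {z ∈ C | G.Adj x z}.ncard + {z ∈ C | G.Adj y z}.ncard ≤ C.ncard := by
  have hdisj : Disjoint {z ∈ C | G.Adj x z} {z ∈ C | G.Adj y z} :=
    Set.disjoint_left.2 fun z ⟨_, hxz⟩ ⟨_, hyz⟩ => not_adj_of_two_lt_dist hxy hxz hyz.symm
  rw [← Set.ncard_union_eq hdisj (hC.sep _) (hC.sep _)]
  exact Set.ncard_le_ncard (Set.union_subset (Set.sep_subset _ _) (Set.sep_subset _ _)) hC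

theorem sum_dist_clique {R : Type*} [Ring R] (e : ℕ → R) {C : Finset V} (hC : G.IsClique C)
    (hne : C.Nonempty) (hx : distToSet G x C = i) : ∑ y ∈ C, e (G.dist x y) =
      C.card * e (i + 1) + {y ∈ C | G.dist x y = i}.card * (e i - e (i + 1)) := by
  obtain ⟨y, hy, hxy⟩ := exists_dist_eq_distToSet (G := G) x (T := C) hne
  have hterm : ∀ z ∈ C, e (G.dist x z) =
      e (i + 1) + if G.dist x z = i then e i - e (i + 1) else 0 := by
    intro z hz
    have hle : distToSet G x C ≤ G.dist x z := distToSet_le hz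
    have hge := dist_le_dist_add_one_of_mem_clique (x := x) hC hy hz
    obtain hi | hi : G.dist x z = i ∨ G.dist x z = i + 1 := by omega
    · simp [hi]
    · simp [hi]
  simp_rw [Finset.sum_congr rfl hterm, Finset.sum_add_distrib, ← Finset.sum_filter,
    Finset.sum_const, nsmul_eq_mul]

end Distance

section Counting

variable {α β : Type*} {T : Set β} {f : β → Set α} {n : ℕ} {p : α}

theorem ncard_biUnion_eq_mul (hT : T.Finite) (hf : ∀ b ∈ T, (f b).Finite)
    (hn : ∀ b ∈ T, (f b).ncard = n) (hdisj : T.PairwiseDisjoint f) :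
    (⋃ b ∈ T, f b).ncard = T.ncard * n := by
  rw [hT.ncard_biUnion hf hdisj, finsum_mem_congr rfl hn, finsum_mem_eq_finite_toFinset_sum _ hT,
    Finset.sum_const, smul_eq_mul, Set.ncard_eq_toFinset_card T hT]

theorem ncard_insert_biUnion_sunflower (hT : T.Finite) (hf : ∀ b ∈ T, (f b).Finite)
    (hn : ∀ b ∈ T, (f b).ncard = n) (hp : ∀ b ∈ T, p ∈ f b)
    (hcore : T.Pairwise fun a b => f a ∩ f b ⊆ {p}) :
    (insert p (⋃ b ∈ T, f b)).ncard = T.ncard * (n - 1) + 1 := by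
  have hfin : ∀ b ∈ T, (f b \ {p}).Finite := fun b hb => (hf b hb).sdiff
  have hdisj : T.PairwiseDisjoint fun b => f b \ {p} := fun a ha b hb hab =>
    Set.disjoint_left.2 fun q hqa hqb => hqa.2 (hcore ha hb hab ⟨hqa.1, hqb.1⟩)
  have hcard : ∀ b ∈ T, (f b \ {p}).ncard = n - 1 := fun b hb => by
    rw [Set.ncard_sdiff_singleton_of_mem (hp b hb), hn b hb]
  rw [← ncard_biUnion_eq_mul hT hfin hcard hdisj,
    ← Set.ncard_insert_of_notMem (a := p) (by simp) (hT.biUnion hfin)]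
  congr 1
  ext q
  by_cases hq : q = p <;> simp [hq]

theorem mul_pred_add_one_le_ncard_of_sunflower (hT : T.Finite) (hn : ∀ b ∈ T, (f b).ncard = n)
    (hp : ∀ b ∈ T, p ∈ f b) (hcore : T.Pairwise fun a b => f a ∩ f b ⊆ {p}) {S : Set α}
    (hSfin : S.Finite) (hpS : p ∈ S) (hS : ∀ b ∈ T, f b ⊆ S) :
    T.ncard * (n - 1) + 1 ≤ S.ncard := by
  rw [← ncard_insert_biUnion_sunflower hT (fun b hb => hSfin.subset (hS b hb)) hn hp hcore]
  exact Set.ncard_le_ncard (Set.insert_subset hpS (Set.iUnion₂_subset hS)) hSfin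

end Counting

section MinimalPolynomial

open Polynomial Matrix

theorem exists_aeval_ne_zero_mul_eq_smul {K S : Type*} [Field K] [Ring S] [Algebra K S] {a : S}
    (ha : IsIntegral K a) {θ : K} (hθ : (minpoly K a).IsRoot θ) :
    ∃ p : K[X], aeval a p ≠ 0 ∧ aeval a p * a = θ • aeval a p := by
  obtain ⟨p, hp⟩ := dvd_iff_isRoot.2 hθ
  rw [mul_comm] at hp
  have hmonic : p.Monic := (monic_X_sub_C θ).of_mul_monic_right (hp ▸ minpoly.monic ha)
  refine ⟨p, minpoly.aeval_ne_zero_of_dvdNotUnit_minpoly ha hmonic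
    ⟨hmonic.ne_zero, _, not_isUnit_X_sub_C θ, hp⟩, ?_⟩
  have h0 := minpoly.aeval K a
  rwa [hp, map_mul, map_sub, aeval_X, aeval_C, mul_sub, sub_eq_zero, ← Algebra.commutes,
    ← Algebra.smul_def] at h0

theorem mul_aeval_eq_eval_smul {R S : Type*} [CommSemiring R] [Semiring S] [Algebra R S]
    {a x : S} {θ : R} (h : x * a = θ • x) (q : R[X]) : x * aeval a q = q.eval θ • x := by
  induction q using Polynomial.induction_on with
  | C r => rw [aeval_C, ← Algebra.commutes, ← Algebra.smul_def, eval_C]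
  | add p q hp hq => rw [map_add, mul_add, hp, hq, eval_add, add_smul]
  | monomial n r ih =>
    rw [pow_succ, ← mul_assoc, map_mul, aeval_X, ← mul_assoc, ih, smul_mul_assoc, h, smul_smul,
      eval_mul_X]

theorem mulVec_eq_zero_of_dotProduct_mulVec_eq_zero {n : Type*} [Fintype n] {M : Matrix n n ℝ}
    (hM : M.IsSymm) {μ : ℝ} (hsq : M * M = μ • M) {v : n → ℝ} (hv : v ⬝ᵥ M *ᵥ v = 0) :
    M *ᵥ v = 0 := by
  rw [← dotProduct_self_eq_zero]
  calc M *ᵥ v ⬝ᵥ M *ᵥ v = v ⬝ᵥ (M * M) *ᵥ v := by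
        rw [← mulVec_mulVec, dotProduct_mulVec v, ← mulVec_transpose, hM.eq]
    _ = 0 := by rw [hsq, smul_mulVec, dotProduct_smul, hv, smul_zero]

end MinimalPolynomial

section IntersectionArray

variable {V : Type*} {G : SimpleGraph V} {b c : ℕ → ℕ} {x y : V} {i : ℕ}

/-- `b` and `c` are intersection numbers of `G`, the defining condition of distance-regularity.
No value of `b i` or `c i` is prescribed when `i` exceeds the diameter. -/
def HasIntersectionArray (G : SimpleGraph V) (b c : ℕ → ℕ) : Prop :=
  ∀ (i : ℕ) (x y : V), G.dist x y = i →
    {z : V | G.Adj y z ∧ G.dist x z + 1 = i}.ncard = c i ∧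
    {z : V | G.Adj y z ∧ G.dist x z = i + 1}.ncard = b i

namespace HasIntersectionArray

theorem ncard_neighborSet (h : HasIntersectionArray G b c) (x : V) :
    (G.neighborSet x).ncard = b 0 := by
  simpa [SimpleGraph.neighborSet] using (h 0 x x G.dist_self).2

theorem ncard_commonNeighbors (h : HasIntersectionArray G b c) (hxy : G.dist x y = 2) :
    (G.commonNeighbors x y).ncard = c 2 := by
  rw [← (h 2 x y hxy).1]
  congr 1 with z
  simp [SimpleGraph.mem_commonNeighbors, and_comm]

theorem c_pos [Finite V] (h : HasIntersectionArray G b c) (hxy : G.dist x y = i + 1) :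
    0 < c (i + 1) := by
  obtain ⟨z, hzy, hxz⟩ := exists_adj_dist_eq hxy
  rw [← (h _ x y hxy).1, Set.ncard_pos]
  exact ⟨z, hzy.symm, by rw [hxz]⟩

theorem sum_neighborFinset [Fintype V] [DecidableRel G.Adj] (h : HasIntersectionArray G b c)
    (e : ℕ → ℝ) (hxy : G.dist x y = i) : ∑ z ∈ G.neighborFinset y, e (G.dist x z) =
      b 0 * e i + c i * (e (i - 1) - e i) + b i * (e (i + 1) - e i) := by
  have hterm : ∀ z ∈ G.neighborFinset y, e (G.dist x z) =
      e i + (if G.dist x z + 1 = i then e (i - 1) - e i else 0) +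
        if G.dist x z = i + 1 then e (i + 1) - e i else 0 := by
    intro z hz
    rw [SimpleGraph.mem_neighborFinset] at hz
    have h₁ := dist_le_dist_add_one_of_adj (x := x) hz
    have h₂ := dist_le_dist_add_one_of_adj (x := x) hz.symm
    obtain hi | hi | hi : G.dist x z + 1 = i ∨ G.dist x z = i ∨ G.dist x z = i + 1 := by omega
    · rw [if_pos hi, if_neg (by omega), add_zero, add_sub_cancel, ← hi, Nat.add_sub_cancel]
    · simp [hi]
    · rw [if_neg (by omega), if_pos hi, add_zero, add_sub_cancel, hi]
  have hk : (G.neighborFinset y).card = b 0 := by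
    rw [← h.ncard_neighborSet y, Set.ncard_eq_toFinset_card', SimpleGraph.neighborFinset]
  have hc : {z ∈ G.neighborFinset y | G.dist x z + 1 = i}.card = c i := by
    rw [← (h i x y hxy).1, ← Set.ncard_coe_finset]
    simp
  have hb : {z ∈ G.neighborFinset y | G.dist x z = i + 1}.card = b i := by
    rw [← (h i x y hxy).2, ← Set.ncard_coe_finset]
    simp
  simp_rw [Finset.sum_congr rfl hterm, Finset.sum_add_distrib, ← Finset.sum_filter,
    Finset.sum_const, nsmul_eq_mul, hk, hc, hb]

end HasIntersectionArray

end IntersectionArray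

section DistanceMatrix

open Polynomial Matrix

variable {V : Type*} {G : SimpleGraph V} {b c : ℕ → ℕ} {e : ℕ → ℝ} {θ : ℝ} {x y : V} {i : ℕ}

/-- The matrix whose entry at `(x, y)` is `e (d(x, y))`. For a distance-regular graph these
matrices form the Bose–Mesner algebra. -/
noncomputable def distMatrix (G : SimpleGraph V) (e : ℕ → ℝ) : Matrix V V ℝ :=
  .of fun x y => e (G.dist x y)

theorem distMatrix_apply (G : SimpleGraph V) (e : ℕ → ℝ) (x y : V) :
    distMatrix G e x y = e (G.dist x y) := rfl

theorem isSymm_distMatrix (G : SimpleGraph V) (e : ℕ → ℝ) : (distMatrix G e).IsSymm :=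
  Matrix.IsSymm.ext fun x y => by rw [distMatrix_apply, distMatrix_apply, G.dist_comm]

variable [Fintype V] [DecidableRel G.Adj]

theorem HasIntersectionArray.exists_distMatrix_mul_adjMatrix_eq (h : HasIntersectionArray G b c)
    (e : ℕ → ℝ) : ∃ f : ℕ → ℝ, distMatrix G e * G.adjMatrix ℝ = distMatrix G f := by
  refine ⟨fun i => b 0 * e i + c i * (e (i - 1) - e i) + b i * (e (i + 1) - e i), ?_⟩
  ext x y
  exact (G.mul_adjMatrix_apply _ x y).trans (h.sum_neighborFinset e rfl)

theorem HasIntersectionArray.exists_aeval_adjMatrix_eq [DecidableEq V]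
    (h : HasIntersectionArray G b c) (hconn : G.Connected) (p : ℝ[X]) :
    ∃ e : ℕ → ℝ, aeval (G.adjMatrix ℝ) p = distMatrix G e := by
  induction p using Polynomial.induction_on with
  | C r =>
    refine ⟨fun i => if i = 0 then r else 0, ?_⟩
    ext x y
    rw [aeval_C, algebraMap_matrix_apply, distMatrix_apply]
    simp [hconn.dist_eq_zero_iff]
  | add p q hp hq =>
    obtain ⟨e, he⟩ := hp
    obtain ⟨f, hf⟩ := hq
    exact ⟨e + f, by rw [map_add, he, hf]; rfl⟩
  | monomial n r ih =>
    obtain ⟨e, he⟩ := ih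
    rw [pow_succ, ← mul_assoc, map_mul, aeval_X, he]
    exact h.exists_distMatrix_mul_adjMatrix_eq e

/-- Up to a scalar, `e` is the cosine sequence of the eigenvalue `θ`: the matrix with entries
`e (d(x, y))` is a nonzero multiple of an idempotent whose image consists of `θ`-eigenvectors. -/
structure IsCosineSequence (G : SimpleGraph V) [DecidableRel G.Adj] (θ : ℝ) (e : ℕ → ℝ) :
    Prop where
  mul_adjMatrix : distMatrix G e * G.adjMatrix ℝ = θ • distMatrix G e
  exists_mul_self : ∃ μ : ℝ, distMatrix G e * distMatrix G e = μ • distMatrix G e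
  ne_zero : distMatrix G e ≠ 0

theorem HasIntersectionArray.exists_isCosineSequence (h : HasIntersectionArray G b c)
    (hconn : G.Connected) (hθ : Module.End.HasEigenvalue (mulVecLin (G.adjMatrix ℝ)) θ) :
    ∃ e, IsCosineSequence G θ e := by
  classical
  have hroot : (minpoly ℝ (G.adjMatrix ℝ)).IsRoot θ := by
    rw [← minpoly_toLin']
    exact Module.End.isRoot_of_hasEigenvalue hθ
  obtain ⟨p, hp, hmul⟩ := exists_aeval_ne_zero_mul_eq_smul (Algebra.IsIntegral.isIntegral _) hroot
  obtain ⟨e, he⟩ := h.exists_aeval_adjMatrix_eq hconn p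
  have hsq := mul_aeval_eq_eval_smul hmul p
  rw [he] at hp hmul hsq
  exact ⟨e, hmul, ⟨_, hsq⟩, hp⟩

namespace IsCosineSequence

theorem sum_neighborFinset (he : IsCosineSequence G θ e) (x y : V) :
    ∑ z ∈ G.neighborFinset y, e (G.dist x z) = θ * e (G.dist x y) :=
  (G.mul_adjMatrix_apply _ x y).symm.trans (congr_fun₂ he.mul_adjMatrix x y)

theorem mul_apply_one [Nonempty V] (he : IsCosineSequence G θ e)
    (h : HasIntersectionArray G b c) : b 0 * e 1 = θ * e 0 := by
  inhabit V
  have hsum := he.sum_neighborFinset (default : V) default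
  rw [h.sum_neighborFinset e rfl, G.dist_self] at hsum
  linear_combination hsum

theorem mulVec_eq_zero (he : IsCosineSequence G θ e) {v : V → ℝ}
    (hv : v ⬝ᵥ distMatrix G e *ᵥ v = 0) : distMatrix G e *ᵥ v = 0 :=
  he.exists_mul_self.elim fun _ hsq =>
    mulVec_eq_zero_of_dotProduct_mulVec_eq_zero (isSymm_distMatrix G e) hsq hv

theorem apply_zero_ne_zero (he : IsCosineSequence G θ e) : e 0 ≠ 0 := by
  classical
  intro h0
  refine he.ne_zero (ext_of_mulVec_single fun x => ?_)
  rw [zero_mulVec]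
  exact he.mulVec_eq_zero (by simp [distMatrix_apply, h0])

theorem not_apply_eq_zero_and (he : IsCosineSequence G θ e) (h : HasIntersectionArray G b c)
    (hxy : G.dist x y = i) : ¬ (e i = 0 ∧ e (i + 1) = 0) := by
  induction i generalizing y with
  | zero => exact fun h0 => he.apply_zero_ne_zero h0.1
  | succ i ih =>
    rintro ⟨h₁, h₂⟩
    obtain ⟨z, -, hxz⟩ := exists_adj_dist_eq hxy
    have hsum := he.sum_neighborFinset x y
    rw [h.sum_neighborFinset e hxy, hxy, h₁, h₂, Nat.add_sub_cancel] at hsum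
    have hc : (c (i + 1) : ℝ) ≠ 0 := Nat.cast_ne_zero.2 (h.c_pos hxy).ne'
    exact ih hxz ⟨(mul_eq_zero.1 (by linear_combination hsum)).resolve_left hc, h₁⟩

/-- The hypothesis on `#C` is equality in Delsarte's bound: it makes the quadratic form of the
matrix of `e` vanish at the characteristic vector of `C`. -/
theorem sum_clique_eq_zero (he : IsCosineSequence G θ e) (h : HasIntersectionArray G b c)
    (hθ : θ ≠ 0) {C : Finset V} (hC : G.IsClique C) (hcard : ((C.card : ℝ) - 1) * θ = -b 0)
    (x : V) : ∑ y ∈ C, e (G.dist x y) = 0 := by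
  classical
  have : Nonempty V := ⟨x⟩
  let v : V → ℝ := fun y => if y ∈ C then 1 else 0
  have hmulVec : ∀ y, (distMatrix G e *ᵥ v) y = ∑ z ∈ C, e (G.dist y z) := fun y => by
    simp [v, mulVec, dotProduct, distMatrix_apply]
  have hrow : ∀ y ∈ C, ∑ z ∈ C, e (G.dist y z) = 0 := by
    intro y hy
    have hterm : ∀ z ∈ C.erase y, e (G.dist y z) = e 1 := fun z hz => by
      rw [Finset.mem_erase] at hz
      rw [G.dist_eq_one_iff_adj.2 (hC hy hz.2 hz.1.symm)]
    rw [← Finset.add_sum_erase C _ hy, Finset.sum_congr rfl hterm, Finset.sum_const, nsmul_eq_mul,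
      Finset.cast_card_erase_of_mem hy, G.dist_self]
    refine (mul_eq_zero.1 (?_ : θ * _ = 0)).resolve_left hθ
    linear_combination e 1 * hcard - he.mul_apply_one h
  rw [← hmulVec, he.mulVec_eq_zero, Pi.zero_apply]
  simpa [v, dotProduct, hmulVec] using Finset.sum_eq_zero hrow

end IsCosineSequence

end DistanceMatrix

section DelsarteClique

variable {V : Type*} [Fintype V] {G : SimpleGraph V} {C D : Set V}

-- `sInf ∅ = 0`, so a nonzero `minEigenvalue G` is a minimum of a nonempty finite set.
open Classical in
theorem hasEigenvalue_minEigenvalue (hθ : minEigenvalue G ≠ 0) :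
    Module.End.HasEigenvalue (Matrix.mulVecLin (G.adjMatrix ℝ)) (minEigenvalue G) := by
  have hne : {θ | Module.End.HasEigenvalue (Matrix.mulVecLin (G.adjMatrix ℝ)) θ}.Nonempty := by
    rw [Set.nonempty_iff_ne_empty]
    intro hempty
    exact hθ (by rw [minEigenvalue, hempty, Real.sInf_empty])
  exact hne.csInf_mem (Module.End.finite_hasEigenvalue _)

namespace IsDelsarteClique

theorem ncard_eq [Nonempty V] (hC : IsDelsarteClique G C) (hD : IsDelsarteClique G D) :
    C.ncard = D.ncard := by
  inhabit V
  obtain ⟨-, k, hk, hCk⟩ := hC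
  obtain ⟨-, l, hl, hDl⟩ := hD
  rw [← hl default, hk default, ← hCk] at hDl
  exact_mod_cast hDl.symm

theorem minEigenvalue_neg (hC : IsDelsarteClique G C) (hcard : 1 < C.ncard) :
    minEigenvalue G < 0 := by
  obtain ⟨-, k, -, hCk⟩ := hC
  by_contra! hθ
  have hcard' : (1 : ℝ) < C.ncard := Nat.one_lt_cast.2 hcard
  have : (k : ℝ) / -minEigenvalue G ≤ 0 :=
    div_nonpos_of_nonneg_of_nonpos k.cast_nonneg (neg_nonpos.2 hθ)
  linarith

theorem nonempty (hC : IsDelsarteClique G C) (hθ : minEigenvalue G < 0) : C.Nonempty := by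
  obtain ⟨-, k, -, hCk⟩ := hC
  have : 0 ≤ (k : ℝ) / -minEigenvalue G := div_nonneg k.cast_nonneg (neg_pos.2 hθ).le
  have hcard : (C.ncard : ℝ) ≠ 0 := by linarith
  exact Set.nonempty_of_ncard_ne_zero (Nat.cast_ne_zero.1 hcard)

theorem ncard_sub_one_mul_neg (hC : IsDelsarteClique G C) (hθ : minEigenvalue G ≠ 0) (x : V) :
    ((C.ncard : ℝ) - 1) * -minEigenvalue G = (G.neighborSet x).ncard := by
  obtain ⟨-, k, hk, hCk⟩ := hC
  rw [hCk, hk, add_sub_cancel_left, div_mul_cancel₀ _ (neg_ne_zero.2 hθ)]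

end IsDelsarteClique

theorem phiValues_subsingleton (hG : IsDistanceRegular G) (hθ : minEigenvalue G < 0) (j : ℕ) :
    (phiValues G j).Subsingleton := by
  classical
  obtain ⟨hconn, b, c, h⟩ := hG
  replace h : HasIntersectionArray G b c := h
  have := hconn.nonempty
  obtain ⟨e, he⟩ := h.exists_isCosineSequence hconn (hasEigenvalue_minEigenvalue hθ.ne)
  have hsum : ∀ C x, IsDelsarteClique G C → distToSet G x C = j →
      C.ncard * e (j + 1) + {y ∈ C | G.dist x y = j}.ncard * (e j - e (j + 1)) = 0 := by
    intro C x hC hx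
    lift C to Finset V using C.toFinite
    have hcard := hC.ncard_sub_one_mul_neg hθ.ne x
    rw [h.ncard_neighborSet, Set.ncard_coe_finset] at hcard
    have hzero := he.sum_clique_eq_zero h hθ.ne hC.1 (by linear_combination -hcard) x
    rw [sum_dist_clique e hC.1 (hC.nonempty hθ) hx] at hzero
    rw [← hzero, Set.ncard_coe_finset, ← Set.ncard_coe_finset (Finset.filter _ _)]
    simp
  rintro _ ⟨C, x, hC, hx, rfl⟩ _ ⟨D, y, hD, hy, rfl⟩
  have hCsum := hsum C x hC hx
  have hDsum := hsum D y hD hy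
  obtain ⟨z, hz, hxz⟩ := exists_dist_eq_distToSet (G := G) x (hC.nonempty hθ)
  have hsub : e j - e (j + 1) ≠ 0 := by
    intro h0
    have hcard : (C.ncard : ℝ) ≠ 0 := Nat.cast_ne_zero.2 (Set.ncard_ne_zero_of_mem hz)
    have hj : e (j + 1) = 0 := by simpa [h0, hcard] using hCsum
    exact he.not_apply_eq_zero_and h (hxz.trans hx) ⟨by linarith, hj⟩
  rw [hC.ncard_eq hD] at hCsum
  refine Nat.cast_injective (R := ℝ) (mul_right_cancel₀ hsub ?_)
  linear_combination hCsum - hDsum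

end DelsarteClique

section Design

variable {α : Type*} {v k : ℕ} {P b b' : Set α} {B : Set (Set α)} {p q : α}

namespace IsDesign

theorem ncard_blocks_eq_one (h : IsDesign 2 v k 1 P B) (hp : p ∈ P) (hq : q ∈ P) (hpq : p ≠ q) :
    {b ∈ B | {p, q} ⊆ b}.ncard = 1 :=
  h.2.2.2.2.2.2 _ (Set.pair_subset hp hq) (Set.ncard_pair hpq)

theorem exists_mem (h : IsDesign 2 v k 1 P B) (hp : p ∈ P) (hq : q ∈ P) (hpq : p ≠ q) :
    ∃ b ∈ B, p ∈ b ∧ q ∈ b := by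
  obtain ⟨b, hb⟩ := Set.ncard_eq_one.1 (h.ncard_blocks_eq_one hp hq hpq)
  obtain ⟨hbB, hpqb⟩ : b ∈ {b ∈ B | {p, q} ⊆ b} := hb ▸ rfl
  exact ⟨b, hbB, Set.pair_subset_iff.1 hpqb⟩

theorem eq_of_mem (h : IsDesign 2 v k 1 P B) (hb : b ∈ B) (hb' : b' ∈ B) (hpq : p ≠ q)
    (hpb : p ∈ b) (hqb : q ∈ b) (hpb' : p ∈ b') (hqb' : q ∈ b') : b = b' := by
  have hbP := (h.2.2.2.2.2.1 b hb).1
  obtain ⟨a, ha⟩ := Set.ncard_eq_one.1 (h.ncard_blocks_eq_one (hbP hpb) (hbP hqb) hpq)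
  exact (ha.subset ⟨hb, Set.pair_subset hpb hqb⟩).trans
    (ha.subset ⟨hb', Set.pair_subset hpb' hqb'⟩).symm

/-- The blocks joining `p` to the points of `b` are a sunflower with core `p`. -/
theorem mul_pred_add_one_le (h : IsDesign 2 v k 1 P B) (hb : b ∈ B) (hp : p ∈ P) (hpb : p ∉ b) :
    k * (k - 1) + 1 ≤ v := by
  have ⟨_, _, _, hPfin, hPcard, hB, _⟩ := h
  have hjoin : ∀ q ∈ b, ∃ a ∈ B, p ∈ a ∧ q ∈ a := fun q hq =>
    h.exists_mem hp ((hB b hb).1 hq) fun e => hpb (e ▸ hq)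
  choose! f hfB hpf hqf using hjoin
  have hcore : b.Pairwise fun q r => f q ∩ f r ⊆ {p} := by
    rintro q hq r hr hqr s ⟨hsq, hsr⟩
    by_contra hsp
    have hfqr : f q = f r :=
      h.eq_of_mem (hfB q hq) (hfB r hr) hsp hsq (hpf q hq) hsr (hpf r hr)
    have hfq : f q = b :=
      h.eq_of_mem (hfB q hq) hb hqr (hqf q hq) (hfqr ▸ hqf r hr) hq hr
    exact hpb (hfq ▸ hpf q hq)
  rw [← hPcard]
  conv_lhs => rw [← (hB b hb).2]
  exact mul_pred_add_one_le_ncard_of_sunflower (hPfin.subset (hB b hb).1)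
    (fun q hq => (hB _ (hfB q hq)).2.trans (hB b hb).2.symm) hpf hcore hPfin hp
    fun q hq => (hB _ (hfB q hq)).1

end IsDesign

end Design

section EdgeCliquePartition

variable {V : Type*} {G : SimpleGraph V} {𝒞 : Set (Set V)} {ℓ m : Set V} {x y z : V}

/-- `𝒞` is a set of cliques (the lines) partitioning the edges of `G`. -/
structure IsEdgeCliquePartition (G : SimpleGraph V) (𝒞 : Set (Set V)) : Prop where
  isClique : ∀ {ℓ}, ℓ ∈ 𝒞 → G.IsClique ℓ
  existsUnique : ∀ {x y}, G.Adj x y → ∃! ℓ, ℓ ∈ 𝒞 ∧ x ∈ ℓ ∧ y ∈ ℓ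

namespace IsEdgeCliquePartition

theorem exists_mem (h : IsEdgeCliquePartition G 𝒞) (hxy : G.Adj x y) :
    ∃ ℓ ∈ 𝒞, x ∈ ℓ ∧ y ∈ ℓ :=
  (h.existsUnique hxy).exists

theorem eq_of_mem (h : IsEdgeCliquePartition G 𝒞) (hℓ : ℓ ∈ 𝒞) (hm : m ∈ 𝒞) (hxy : x ≠ y)
    (hxℓ : x ∈ ℓ) (hyℓ : y ∈ ℓ) (hxm : x ∈ m) (hym : y ∈ m) : ℓ = m :=
  (h.existsUnique (h.isClique hℓ hxℓ hyℓ hxy)).unique ⟨hℓ, hxℓ, hyℓ⟩ ⟨hm, hxm, hym⟩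

theorem notMem_of_dist_eq_two (h : IsEdgeCliquePartition G 𝒞) (hℓ : ℓ ∈ 𝒞) (hx : x ∈ ℓ)
    (hxy : G.dist x y = 2) : y ∉ ℓ := fun hy =>
  have ⟨hne, hadj, _⟩ := dist_eq_two_iff.1 hxy
  hadj (h.isClique hℓ hx hy hne)

theorem mem_lineSet_iff (h : IsEdgeCliquePartition G 𝒞) (hxy : G.dist x y = 2) :
    ℓ ∈ lineSet G 𝒞 x y ↔ ℓ ∈ 𝒞 ∧ x ∈ ℓ ∧ ∃ p ∈ ℓ, G.Adj y p :=
  and_congr_right fun hℓ => and_congr_right fun hx =>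
    distToSet_clique_eq_one_iff (h.isClique hℓ) (h.notMem_of_dist_eq_two hℓ hx hxy)

theorem adj_of_mem_of_dist_eq_two (h : IsEdgeCliquePartition G 𝒞) (hxy : G.dist x y = 2)
    (hℓ : ℓ ∈ 𝒞) (hx : x ∈ ℓ) (hz : z ∈ ℓ) (hyz : G.Adj y z) : G.Adj x z := by
  refine h.isClique hℓ hx hz ?_
  rintro rfl
  exact (dist_eq_two_iff.1 hxy).2.1 hyz.symm

variable [Finite V]

theorem ncard_neighborSet (h : IsEdgeCliquePartition G 𝒞) {s : ℕ}
    (hs : ∀ ℓ ∈ 𝒞, ℓ.ncard = s) (z : V) :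
    (G.neighborSet z).ncard = {ℓ ∈ 𝒞 | z ∈ ℓ}.ncard * (s - 1) := by
  have hunion : insert z (⋃ ℓ ∈ {ℓ ∈ 𝒞 | z ∈ ℓ}, ℓ) = insert z (G.neighborSet z) := by
    ext w
    simp only [Set.mem_insert_iff, Set.mem_iUnion, Set.mem_ofPred_eq, exists_prop,
      SimpleGraph.mem_neighborSet]
    refine or_congr_right' fun hwz => ⟨?_, ?_⟩
    · rintro ⟨ℓ, ⟨hℓ, hz⟩, hw⟩
      exact h.isClique hℓ hz hw (Ne.symm hwz)
    · intro hzw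
      obtain ⟨ℓ, hℓ, hz, hw⟩ := h.exists_mem hzw
      exact ⟨ℓ, ⟨hℓ, hz⟩, hw⟩
  have hcount := ncard_insert_biUnion_sunflower (Set.toFinite {ℓ ∈ 𝒞 | z ∈ ℓ}) (f := id)
    (fun ℓ _ => Set.toFinite ℓ) (fun ℓ hℓ => hs ℓ hℓ.1) (fun ℓ hℓ => hℓ.2)
    fun ℓ hℓ m hm hne w hw => by_contra fun hwz =>
      hne (h.eq_of_mem hℓ.1 hm.1 hwz hw.1 hℓ.2 hw.2 hm.2)
  simp only [id_eq] at hcount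
  rw [hunion, Set.ncard_insert_of_notMem G.notMem_neighborSet_self] at hcount
  exact Nat.succ_injective hcount

theorem ncard_commonNeighbors (h : IsEdgeCliquePartition G 𝒞) {φ : ℕ}
    (hφ : ∀ ℓ ∈ lineSet G 𝒞 x y, {z ∈ ℓ | G.Adj y z}.ncard = φ) (hxy : G.dist x y = 2) :
    (G.commonNeighbors x y).ncard = (lineSet G 𝒞 x y).ncard * φ := by
  have hunion : ⋃ ℓ ∈ lineSet G 𝒞 x y, {z ∈ ℓ | G.Adj y z} = G.commonNeighbors x y := by
    ext z
    simp only [Set.mem_iUnion, Set.mem_ofPred_eq, exists_prop, SimpleGraph.mem_commonNeighbors]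
    constructor
    · rintro ⟨ℓ, hℓ, hz, hyz⟩
      exact ⟨h.adj_of_mem_of_dist_eq_two hxy hℓ.1 hℓ.2.1 hz hyz, hyz⟩
    · rintro ⟨hxz, hyz⟩
      obtain ⟨ℓ, hℓ, hx, hz⟩ := h.exists_mem hxz
      exact ⟨ℓ, (h.mem_lineSet_iff hxy).2 ⟨hℓ, hx, z, hz, hyz⟩, hz, hyz⟩
  rw [← hunion]
  refine ncard_biUnion_eq_mul (Set.toFinite _) (fun ℓ _ => Set.toFinite _) hφ
    fun ℓ hℓ m hm hne => Set.disjoint_left.2 fun z hzℓ hzm => hne ?_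
  have hxz := h.adj_of_mem_of_dist_eq_two hxy hℓ.1 hℓ.2.1 hzℓ.1 hzℓ.2
  exact h.eq_of_mem hℓ.1 hm.1 hxz.ne hℓ.2.1 hzℓ.1 hm.2.1 hzm.1

end IsEdgeCliquePartition

end EdgeCliquePartition

section ELSGeometry

variable {V : Type*} {G : SimpleGraph V} {𝒞 : Set (Set V)} {φ : ℕ} {ℓ m C : Set V}
  {a p u v w x x' y z z' : V}

/-- The local structure of a geometric distance-regular graph with the ELS property: an edge
clique partition with that property in which a vertex outside a line has either no or exactly
`φ` neighbours on it, where `2 ≤ φ` and every line has at least `φ + 2` vertices. Here `φ` stands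
for `φ₁`. -/
structure IsELSGeometry (G : SimpleGraph V) (𝒞 : Set (Set V)) (φ : ℕ) : Prop
    extends IsEdgeCliquePartition G 𝒞 where
  ncard_adj : ∀ {ℓ x y}, ℓ ∈ 𝒞 → x ∉ ℓ → y ∈ ℓ → G.Adj x y → {z ∈ ℓ | G.Adj x z}.ncard = φ
  two_le : 2 ≤ φ
  add_two_le_ncard : ∀ {ℓ}, ℓ ∈ 𝒞 → φ + 2 ≤ ℓ.ncard
  hasELS : HasELS G 𝒞

namespace IsELSGeometry

theorem lineSet_eq (h : IsELSGeometry G 𝒞 φ) (hℓ : ℓ ∈ 𝒞) (hx : x ∉ ℓ) (hw : w ∈ ℓ)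
    (hxw : G.Adj x w) (hy : y ∈ ℓ) (hz : z ∈ ℓ) (hxy : G.dist x y = 2) (hxz : G.dist x z = 2) :
    lineSet G 𝒞 x y = lineSet G 𝒞 x z := by
  rcases eq_or_ne y z with rfl | hyz
  · rfl
  · exact h.hasELS x ℓ hℓ ((distToSet_clique_eq_one_iff (h.isClique hℓ) hx).2 ⟨w, hw, hxw⟩)
      y hy z hz hyz hxy hxz

theorem exists_ne_adj (h : IsELSGeometry G 𝒞 φ) (hℓ : ℓ ∈ 𝒞) (hx : x ∉ ℓ) (hy : y ∈ ℓ)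
    (hxy : G.Adj x y) : ∃ z ∈ ℓ, z ≠ y ∧ G.Adj x z := by
  obtain ⟨z, ⟨hz, hxz⟩, hzy⟩ :=
    Set.exists_ne_of_one_lt_ncard (h.two_le.trans_eq (h.ncard_adj hℓ hx hy hxy).symm) y
  exact ⟨z, hz, hzy, hxz⟩

theorem exists_ne_dist_eq_two (h : IsELSGeometry G 𝒞 φ) (hℓ : ℓ ∈ 𝒞) (hx : x ∉ ℓ) (hy : y ∈ ℓ)
    (hxy : G.Adj x y) (w : V) : ∃ z ∈ ℓ, z ≠ w ∧ G.dist x z = 2 := by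
  have hlt : (insert w {z ∈ ℓ | G.Adj x z}).ncard < ℓ.ncard := by
    have := Set.ncard_insert_le w {z ∈ ℓ | G.Adj x z}
    have := h.ncard_adj hℓ hx hy hxy
    have := h.add_two_le_ncard hℓ
    omega
  have hfin : {z ∈ ℓ | G.Adj x z}.Finite := by
    refine Set.finite_of_ncard_ne_zero ?_
    have := h.ncard_adj hℓ hx hy hxy
    have := h.two_le
    omega
  obtain ⟨z, hz, hzw⟩ := Set.exists_mem_notMem_of_ncard_lt_ncard hlt (hfin.insert w)
  rw [Set.mem_insert_iff, not_or] at hzw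
  exact ⟨z, hz, hzw.1,
    dist_eq_two_of_mem_clique (h.isClique hℓ) hx hy hz hxy fun hxz => hzw.2 ⟨hz, hxz⟩⟩

theorem exists_adj_dist_eq_two (h : IsELSGeometry G 𝒞 φ) (hℓ : ℓ ∈ 𝒞) (hw : w ∉ ℓ) (hz : z ∉ ℓ)
    (hx : x ∈ ℓ) (hwx : G.Adj w x) (hzx : ¬ G.Adj z x) (hp : p ∈ ℓ) (hzp : G.Adj z p) :
    ∃ q ∈ ℓ, G.Adj z q ∧ G.dist w q = 2 := by
  have hw_card := h.ncard_adj hℓ hw hx hwx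
  have hz_card := h.ncard_adj hℓ hz hp hzp
  have hfin : {q ∈ ℓ | G.Adj w q}.Finite := by
    refine Set.finite_of_ncard_ne_zero ?_
    have := h.two_le
    omega
  by_contra! hcon
  have hsub : {q ∈ ℓ | G.Adj z q} ⊆ {q ∈ ℓ | G.Adj w q} := fun q ⟨hq, hzq⟩ =>
    ⟨hq, by_contra fun hwq =>
      hcon q hq hzq (dist_eq_two_of_mem_clique (h.isClique hℓ) hw hx hq hwx hwq)⟩
  have heq := Set.eq_of_subset_of_ncard_le hsub (hw_card.trans hz_card.symm).le hfin
  have hxz : x ∈ {q ∈ ℓ | G.Adj z q} := heq ▸ ⟨hx, hwx⟩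
  exact hzx hxz.2

theorem exists_mem_lineSet (h : IsELSGeometry G 𝒞 φ) (hℓ : ℓ ∈ 𝒞) (hm : m ∈ 𝒞) (hℓm : ℓ ≠ m)
    (hxℓ : x ∈ ℓ) (hxm : x ∈ m) :
    ∃ z, G.dist x z = 2 ∧ ℓ ∈ lineSet G 𝒞 x z ∧ m ∈ lineSet G 𝒞 x z := by
  obtain ⟨y, hy, hyx⟩ : ∃ y ∈ m, y ≠ x :=
    Set.exists_ne_of_one_lt_ncard (by have := h.add_two_le_ncard hm; omega) x
  have hyℓ : y ∉ ℓ := fun hyℓ => hℓm (h.eq_of_mem hℓ hm hyx hyℓ hxℓ hy hxm)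
  have hyx_adj : G.Adj y x := h.isClique hm hy hxm hyx
  obtain ⟨w, hw, hwx, hyw⟩ := h.exists_ne_adj hℓ hyℓ hxℓ hyx_adj
  obtain ⟨n, hn, hyn, hwn⟩ := h.exists_mem hyw
  have hxn : x ∉ n := fun hxn => hyℓ (h.eq_of_mem hℓ hn hwx hw hxℓ hwn hxn ▸ hyn)
  obtain ⟨z, hz, -, hxz⟩ := h.exists_ne_dist_eq_two hn hxn hyn hyx_adj.symm x
  refine ⟨z, hxz, (h.mem_lineSet_iff hxz).2 ⟨hℓ, hxℓ, w, hw, ?_⟩,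
    (h.mem_lineSet_iff hxz).2 ⟨hm, hxm, y, hy, ?_⟩⟩
  · exact h.isClique hn hz hwn fun e => h.notMem_of_dist_eq_two hℓ hxℓ hxz (e ▸ hw)
  · exact h.isClique hn hz hyn fun e => h.notMem_of_dist_eq_two hm hxm hxz (e ▸ hy)

theorem exists_ne_mem_lineSet (h : IsELSGeometry G 𝒞 φ) (hxz : G.dist x z = 2)
    (hℓ : ℓ ∈ lineSet G 𝒞 x z) : ∃ m ∈ lineSet G 𝒞 x z, m ≠ ℓ := by
  have hzx : G.dist z x = 2 := by rwa [G.dist_comm]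
  obtain ⟨hℓ, hx, w, hw, hzw⟩ := (h.mem_lineSet_iff hxz).1 hℓ
  obtain ⟨n, hn, hzn, hwn⟩ := h.exists_mem hzw
  have hxn := h.notMem_of_dist_eq_two hn hzn hzx
  have hxw := h.adj_of_mem_of_dist_eq_two hxz hℓ hx hw hzw
  obtain ⟨v, hv, hvw, hxv⟩ := h.exists_ne_adj hn hxn hwn hxw
  have hzv := h.adj_of_mem_of_dist_eq_two hzx hn hzn hv hxv
  obtain ⟨m, hm, hxm, hvm⟩ := h.exists_mem hxv
  refine ⟨m, (h.mem_lineSet_iff hxz).2 ⟨hm, hxm, v, hvm, hzv⟩, ?_⟩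
  rintro rfl
  exact hxn (h.eq_of_mem hn hℓ hvw hv hwn hvm hw ▸ hx)

theorem two_le_ncard_lineSet [Finite V] (h : IsELSGeometry G 𝒞 φ) (hxz : G.dist x z = 2) :
    2 ≤ (lineSet G 𝒞 x z).ncard := by
  obtain ⟨-, -, w, hxw, hzw⟩ := dist_eq_two_iff.1 hxz
  obtain ⟨ℓ, hℓ, hx, hw⟩ := h.exists_mem hxw
  have hmem : ℓ ∈ lineSet G 𝒞 x z := (h.mem_lineSet_iff hxz).2 ⟨hℓ, hx, w, hw, hzw⟩
  obtain ⟨m, hm, hne⟩ := h.exists_ne_mem_lineSet hxz hmem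
  exact (Set.one_lt_ncard_iff (Set.toFinite _)).2 ⟨ℓ, m, hmem, hm, hne.symm⟩

theorem lineSet_eq_of_mem_lineSet (h : IsELSGeometry G 𝒞 φ) (hxx' : x ≠ x') (hx' : x' ∈ ℓ)
    (hxz : G.dist x z = 2) (hx'z : G.dist x' z = 2) (hℓ : ℓ ∈ lineSet G 𝒞 x z)
    (hm : m ∈ lineSet G 𝒞 x z) (hℓm : ℓ ≠ m) (hp : p ∈ m) (hx'p : G.dist x' p = 2) :
    lineSet G 𝒞 x' p = lineSet G 𝒞 x' z := by
  obtain ⟨hℓ, hxℓ, w, hw, hzw⟩ := (h.mem_lineSet_iff hxz).1 hℓ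
  obtain ⟨hm, hxm, v, hv, hzv⟩ := (h.mem_lineSet_iff hxz).1 hm
  have hzx : G.dist z x = 2 := by rwa [G.dist_comm]
  have hzx' : G.dist z x' = 2 := by rwa [G.dist_comm]
  have hx'm : x' ∉ m := fun hx'm => hℓm (h.eq_of_mem hℓ hm hxx' hxℓ hx' hxm hx'm)
  have hzℓ := h.notMem_of_dist_eq_two hℓ hxℓ hxz
  have hzm := h.notMem_of_dist_eq_two hm hxm hxz
  have hx'x : G.Adj x' x := h.isClique hℓ hx' hxℓ hxx'.symm
  obtain ⟨q, hq, hzq, hx'q⟩ := h.exists_adj_dist_eq_two hm hx'm hzm hxm hx'x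
    (dist_eq_two_iff.1 hzx).2.1 hv hzv
  obtain ⟨n, hn, hzn, hqn⟩ := h.exists_mem hzq
  have hxq : G.Adj x q := h.adj_of_mem_of_dist_eq_two hxz hm hxm hq hzq
  have hnx : n ∈ lineSet G 𝒞 z x := (h.mem_lineSet_iff hzx).2 ⟨hn, hzn, q, hqn, hxq⟩
  rw [h.lineSet_eq hℓ hzℓ hw hzw hxℓ hx' hzx hzx'] at hnx
  obtain ⟨-, -, t, ht, hx't⟩ := (h.mem_lineSet_iff hzx').1 hnx
  have hx'n := h.notMem_of_dist_eq_two hn hzn hzx'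
  calc lineSet G 𝒞 x' p = lineSet G 𝒞 x' q := h.lineSet_eq hm hx'm hxm hx'x hp hq hx'p hx'q
    _ = lineSet G 𝒞 x' z := h.lineSet_eq hn hx'n ht hx't hqn hzn hx'q hx'z

theorem lineSet_eq_of_common_lines (h : IsELSGeometry G 𝒞 φ) (hxx' : x ≠ x') (hx' : x' ∈ ℓ)
    (hxz : G.dist x z = 2) (hxz' : G.dist x z' = 2) (hx'z : G.dist x' z = 2)
    (hx'z' : G.dist x' z' = 2) (hℓm : ℓ ≠ m) (hℓz : ℓ ∈ lineSet G 𝒞 x z)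
    (hmz : m ∈ lineSet G 𝒞 x z) (hℓz' : ℓ ∈ lineSet G 𝒞 x z') (hmz' : m ∈ lineSet G 𝒞 x z') :
    lineSet G 𝒞 x' z = lineSet G 𝒞 x' z' := by
  have hx'm : x' ∉ m := fun hx'm =>
    hℓm (h.eq_of_mem hℓz.1 hmz.1 hxx' hℓz.2.1 hx' hmz.2.1 hx'm)
  have hx'x : G.Adj x' x := h.isClique hℓz.1 hx' hℓz.2.1 hxx'.symm
  obtain ⟨q, hq, -, hx'q⟩ := h.exists_ne_dist_eq_two hmz.1 hx'm hmz.2.1 hx'x x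
  calc lineSet G 𝒞 x' z = lineSet G 𝒞 x' q :=
        (h.lineSet_eq_of_mem_lineSet hxx' hx' hxz hx'z hℓz hmz hℓm hq hx'q).symm
    _ = lineSet G 𝒞 x' z' := h.lineSet_eq_of_mem_lineSet hxx' hx' hxz' hx'z' hℓz' hmz' hℓm hq hx'q

theorem lineSet_unique_of_adj (h : IsELSGeometry G 𝒞 φ) (hxx' : x ≠ x') (hx' : x' ∈ ℓ)
    (hxz : G.dist x z = 2) (hxz' : G.dist x z' = 2) (hx'z : G.dist x' z = 2) (hx'z' : G.Adj x' z')
    (hℓm : ℓ ≠ m) (hℓz : ℓ ∈ lineSet G 𝒞 x z) (hmz : m ∈ lineSet G 𝒞 x z)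
    (hmz' : m ∈ lineSet G 𝒞 x z') : lineSet G 𝒞 x z = lineSet G 𝒞 x z' := by
  obtain ⟨hm, hxm, p, hp, hz'p⟩ := (h.mem_lineSet_iff hxz').1 hmz'
  have hxℓ : x ∈ ℓ := hℓz.2.1
  have hx'm : x' ∉ m := fun hx'm => hℓm (h.eq_of_mem hℓz.1 hm hxx' hxℓ hx' hxm hx'm)
  have hx'x : G.Adj x' x := h.isClique hℓz.1 hx' hxℓ hxx'.symm
  have hz'x : ¬ G.Adj z' x := fun hz'x => (dist_eq_two_iff.1 hxz').2.1 hz'x.symm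
  obtain ⟨q, hq, hz'q, hx'q⟩ := h.exists_adj_dist_eq_two hm hx'm
    (h.notMem_of_dist_eq_two hm hxm hxz') hxm hx'x hz'x hp hz'p
  obtain ⟨n, hn, hx'n, hz'n⟩ := h.exists_mem hx'z'
  have hℓn : ℓ ≠ n := fun e => h.notMem_of_dist_eq_two hℓz.1 hxℓ hxz' (e ▸ hz'n)
  have hℓx'z : ℓ ∈ lineSet G 𝒞 x' z := ⟨hℓz.1, hx', hℓz.2.2⟩
  have hnx'z : n ∈ lineSet G 𝒞 x' z := by
    rw [← h.lineSet_eq_of_mem_lineSet hxx' hx' hxz hx'z hℓz hmz hℓm hq hx'q]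
    exact (h.mem_lineSet_iff hx'q).2 ⟨hn, hx'n, z', hz'n, hz'q.symm⟩
  exact (h.lineSet_eq_of_mem_lineSet hxx'.symm hxℓ hx'z hxz hℓx'z hnx'z hℓn hz'n hxz').symm

theorem lineSet_unique (h : IsELSGeometry G 𝒞 φ) (hxz : G.dist x z = 2) (hxz' : G.dist x z' = 2)
    (hℓm : ℓ ≠ m) (hℓz : ℓ ∈ lineSet G 𝒞 x z) (hmz : m ∈ lineSet G 𝒞 x z)
    (hℓz' : ℓ ∈ lineSet G 𝒞 x z') (hmz' : m ∈ lineSet G 𝒞 x z') :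
    lineSet G 𝒞 x z = lineSet G 𝒞 x z' := by
  obtain ⟨hℓ, hx, w, hw, hzw⟩ := (h.mem_lineSet_iff hxz).1 hℓz
  obtain ⟨-, -, w', hw', hz'w'⟩ := (h.mem_lineSet_iff hxz').1 hℓz'
  obtain ⟨x', hx', hx'x, hzx'⟩ :=
    h.exists_ne_dist_eq_two hℓ (h.notMem_of_dist_eq_two hℓ hx hxz) hw hzw x
  have hx'z : G.dist x' z = 2 := by rwa [G.dist_comm]
  by_cases hadj : G.Adj x' z'
  · exact h.lineSet_unique_of_adj hx'x.symm hx' hxz hxz' hx'z hadj hℓm hℓz hmz hmz'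
  · have hx'z' : G.dist x' z' = 2 := by
      rw [G.dist_comm]
      exact dist_eq_two_of_mem_clique (h.isClique hℓ) (h.notMem_of_dist_eq_two hℓ hx hxz') hw' hx'
        hz'w' fun hz'x' => hadj hz'x'.symm
    have hx'eq : lineSet G 𝒞 x' z = lineSet G 𝒞 x' z' :=
      h.lineSet_eq_of_common_lines hx'x.symm hx' hxz hxz' hx'z hx'z' hℓm hℓz hmz hℓz' hmz'
    have hℓx'z : ℓ ∈ lineSet G 𝒞 x' z := ⟨hℓ, hx', hℓz.2.2⟩
    obtain ⟨n, hn, hnℓ⟩ := h.exists_ne_mem_lineSet hx'z hℓx'z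
    exact h.lineSet_eq_of_common_lines hx'x hx hx'z hx'z' hxz hxz' hnℓ.symm hℓx'z hn
      (hx'eq ▸ hℓx'z) (hx'eq ▸ hn)

theorem isDesign [Finite V] (h : IsELSGeometry G 𝒞 φ) {r τ : ℕ} (huv : G.dist u v = 2)
    (hr : ∀ x, {ℓ ∈ 𝒞 | x ∈ ℓ}.ncard = r)
    (hτ : ∀ x z, G.dist x z = 2 → (lineSet G 𝒞 x z).ncard = τ) (x : V) :
    IsDesign 2 r τ 1 {ℓ ∈ 𝒞 | x ∈ ℓ} {b | ∃ z : V, G.dist x z = 2 ∧ b = lineSet G 𝒞 x z} := by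
  have hsub : ∀ x z, lineSet G 𝒞 x z ⊆ {ℓ ∈ 𝒞 | x ∈ ℓ} := fun _ _ _ hℓ => ⟨hℓ.1, hℓ.2.1⟩
  refine ⟨hτ u v huv ▸ h.two_le_ncard_lineSet huv, ?_, le_rfl, Set.toFinite _, hr x, ?_, ?_⟩
  · rw [← hτ u v huv, ← hr u]
    exact Set.ncard_le_ncard (hsub u v)
  · rintro b ⟨z, hz, rfl⟩
    exact ⟨hsub x z, hτ x z hz⟩
  · intro T hT hcard
    obtain ⟨ℓ, m, hℓm, rfl⟩ := Set.ncard_eq_two.1 hcard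
    obtain ⟨⟨hℓ, hxℓ⟩, hm, hxm⟩ := Set.pair_subset_iff.1 hT
    obtain ⟨z, hz, hℓz, hmz⟩ := h.exists_mem_lineSet hℓ hm hℓm hxℓ hxm
    refine Set.ncard_eq_one.2 ⟨lineSet G 𝒞 x z, Set.eq_singleton_iff_unique_mem.2
      ⟨⟨⟨z, hz, rfl⟩, Set.pair_subset hℓz hmz⟩, ?_⟩⟩
    rintro b ⟨⟨z', hz', rfl⟩, hb⟩
    obtain ⟨hℓz', hmz'⟩ := Set.pair_subset_iff.1 hb
    exact h.lineSet_unique hz' hz hℓm hℓz' hmz' hℓz hmz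

theorem adj_of_lineSet_eq (h : IsELSGeometry G 𝒞 φ) (hC : C ∈ 𝒞) (hu : u ∈ C) (hv : v ∈ C)
    (hy : y ∈ C) (hxy : 2 < G.dist x y) (hxu : G.dist x u = 2)
    (huv : lineSet G 𝒞 x u = lineSet G 𝒞 x v) (hxa : G.Adj x a) (hua : G.Adj u a) :
    G.Adj v a := by
  have haC : a ∉ C := fun haC => not_adj_of_mem_clique (h.isClique hC) hy haC hxy hxa
  by_contra hva
  have hav : G.dist a v = 2 := dist_eq_two_of_mem_clique (h.isClique hC) haC hu hv hua.symm
    fun hav => hva hav.symm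
  have hay : G.dist a y = 2 := dist_eq_two_of_mem_clique (h.isClique hC) haC hu hy hua.symm
    (not_adj_of_two_lt_dist hxy hxa)
  obtain ⟨ℓ, hℓ, hx, ha⟩ := h.exists_mem hxa
  have hℓv : ℓ ∈ lineSet G 𝒞 x v := huv ▸ (h.mem_lineSet_iff hxu).2 ⟨hℓ, hx, a, ha, hua⟩
  have hℓy : ℓ ∈ lineSet G 𝒞 a y :=
    h.lineSet_eq hC haC hu hua.symm hv hy hav hay ▸ ⟨hℓ, ha, hℓv.2.2⟩
  obtain ⟨-, -, p, hp, hyp⟩ := (h.mem_lineSet_iff hay).1 hℓy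
  exact not_adj_of_mem_clique (h.isClique hℓ) hx hp (by rwa [G.dist_comm]) hyp

theorem lineSet_ne_of_mem_clique (h : IsELSGeometry G 𝒞 φ) (hC : C ∈ 𝒞) (hu : u ∈ C) (hv : v ∈ C)
    (hy : y ∈ C) (hxy : 2 < G.dist x y) (hxu : G.dist x u = 2) (huv : u ≠ v) :
    lineSet G 𝒞 x u ≠ lineSet G 𝒞 x v := by
  intro heq
  have hux : G.dist u x = 2 := by rwa [G.dist_comm]
  obtain ⟨-, hxu_adj, a, hxa, hua⟩ := dist_eq_two_iff.1 hxu
  obtain ⟨n, hn, hun, han⟩ := h.exists_mem hua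
  have hxn : x ∉ n := h.notMem_of_dist_eq_two hn hun hux
  have hvn : v ∉ n := fun hvn => not_adj_of_mem_clique (h.isClique hC) hy
    (h.eq_of_mem hn hC huv hun hvn hu hv ▸ han) hxy hxa
  obtain ⟨q, hq, hxq, hvq⟩ := h.exists_adj_dist_eq_two hn hvn hxn hun
    (h.isClique hC hv hu huv.symm) hxu_adj han hxa
  have huq : G.Adj u q := h.adj_of_mem_of_dist_eq_two hux hn hun hq hxq
  exact (dist_eq_two_iff.1 hvq).2.1 (h.adj_of_lineSet_eq hC hu hv hy hxy hxu heq hxq huq)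

theorem ncard_lineSet_mul_pred_add_one_le [Finite V] (h : IsELSGeometry G 𝒞 φ) (hC : C ∈ 𝒞)
    (hu : u ∈ C) (hy : y ∈ C) (hxy : 2 < G.dist x y) (hxu : G.dist x u = 2) :
    (lineSet G 𝒞 x u).ncard * (φ - 1) + 1 ≤ {v ∈ C | G.dist x v = 2}.ncard := by
  have : Nonempty V := ⟨x⟩
  have hex : ∀ ℓ ∈ lineSet G 𝒞 x u, ∃ a ∈ ℓ, G.Adj u a := fun ℓ hℓ =>
    ((h.mem_lineSet_iff hxu).1 hℓ).2.2
  choose! a haℓ hua using hex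
  have hxa : ∀ ℓ ∈ lineSet G 𝒞 x u, G.Adj x (a ℓ) := fun ℓ hℓ =>
    h.adj_of_mem_of_dist_eq_two hxu hℓ.1 hℓ.2.1 (haℓ ℓ hℓ) (hua ℓ hℓ)
  have hxC : ∀ v ∈ C, ¬ G.Adj x v := fun v hv => not_adj_of_mem_clique (h.isClique hC) hy hv hxy
  have hxC_notMem : x ∉ C := h.notMem_of_dist_eq_two hC hu (by rwa [G.dist_comm])
  have hdist : ∀ ℓ ∈ lineSet G 𝒞 x u, ∀ v ∈ C, G.Adj (a ℓ) v → G.dist x v = 2 :=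
    fun ℓ hℓ v hv hav =>
      dist_eq_two_iff.2 ⟨fun e => hxC_notMem (e ▸ hv), hxC v hv, a ℓ, hxa ℓ hℓ, hav.symm⟩
  refine mul_pred_add_one_le_ncard_of_sunflower (f := fun ℓ => {v ∈ C | G.Adj (a ℓ) v}) (p := u)
    (Set.toFinite _) (fun ℓ hℓ => ?_) (fun ℓ hℓ => ⟨hu, (hua ℓ hℓ).symm⟩) ?_ (Set.toFinite _)
    ⟨hu, hxu⟩ fun ℓ hℓ v hv => ⟨hv.1, hdist ℓ hℓ v hv.1 hv.2⟩
  · exact h.ncard_adj hC (fun haC => hxC _ haC (hxa ℓ hℓ)) hu (hua ℓ hℓ).symm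
  · rintro ℓ hℓ m hm hℓm v ⟨⟨hv, hℓv⟩, -, hmv⟩
    by_contra hvu
    have hxv := hdist ℓ hℓ v hv hℓv
    have hmem : ∀ n ∈ lineSet G 𝒞 x u, G.Adj (a n) v → n ∈ lineSet G 𝒞 x v := fun n hn hnv =>
      (h.mem_lineSet_iff hxv).2 ⟨hn.1, hn.2.1, a n, haℓ n hn, hnv.symm⟩
    exact h.lineSet_ne_of_mem_clique hC hu hv hy hxy hxu (Ne.symm hvu)
      (h.lineSet_unique hxu hxv hℓm hℓ hm (hmem ℓ hℓ hℓv) (hmem m hm hmv))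

end IsELSGeometry

end ELSGeometry

section GeometricGraph

variable {V : Type*} {G : SimpleGraph V} {𝒞 : Set (Set V)} {ℓ m C : Set V} {x y z u : V}
  {i n : ℕ}

theorem eq_singleton_sInf {S : Set ℕ} (hS : S.Subsingleton) (hn : n ∈ S) : S = {sInf S} :=
  Set.eq_singleton_iff_unique_mem.2
    ⟨Nat.sInf_mem ⟨n, hn⟩, fun _ hk => hS hk (Nat.sInf_mem ⟨n, hn⟩)⟩

theorem ncard_lineSet_mem_tauValues (hxy : G.dist x y = 2) :
    (lineSet G 𝒞 x y).ncard ∈ tauValues G 𝒞 2 :=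
  ⟨x, y, hxy, by simp only [lineSet, Nat.reduceEqDiff]⟩

variable [Fintype V]

namespace IsGeometric

theorem isEdgeCliquePartition (hG : IsGeometric G 𝒞) : IsEdgeCliquePartition G 𝒞 where
  isClique hℓ := (hG.2.1 _ hℓ).1
  existsUnique := hG.2.2 _ _

theorem minEigenvalue_neg (hG : IsGeometric G 𝒞) (hxy : G.Adj x y) : minEigenvalue G < 0 := by
  obtain ⟨ℓ, hℓ, hx, hy⟩ := hG.isEdgeCliquePartition.exists_mem hxy
  exact (hG.2.1 ℓ hℓ).minEigenvalue_neg
    ((Set.one_lt_ncard_iff (Set.toFinite ℓ)).2 ⟨x, y, hx, hy, hxy.ne⟩)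

theorem ncard_eq (hG : IsGeometric G 𝒞) (hℓ : ℓ ∈ 𝒞) (hm : m ∈ 𝒞) : ℓ.ncard = m.ncard :=
  have := hG.1.1.nonempty
  (hG.2.1 ℓ hℓ).ncard_eq (hG.2.1 m hm)

theorem ncard_lines_eq (hG : IsGeometric G 𝒞) (hxy : G.Adj x y) (z : V) :
    ({ℓ ∈ 𝒞 | z ∈ ℓ}.ncard : ℝ) = -minEigenvalue G := by
  obtain ⟨C, hC, hx, hy⟩ := hG.isEdgeCliquePartition.exists_mem hxy
  have hcard : 1 < C.ncard := (Set.one_lt_ncard_iff (Set.toFinite C)).2 ⟨x, y, hx, hy, hxy.ne⟩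
  have hcount := hG.isEdgeCliquePartition.ncard_neighborSet (fun ℓ hℓ => hG.ncard_eq hℓ hC) z
  have hDelsarte := (hG.2.1 C hC).ncard_sub_one_mul_neg (hG.minEigenvalue_neg hxy).ne z
  rw [hcount, Nat.cast_mul, Nat.cast_pred (by omega), mul_comm] at hDelsarte
  exact (mul_right_cancel₀ (sub_ne_zero.2 (by exact_mod_cast hcard.ne')) hDelsarte).symm

theorem ncard_mem_phiValues (hG : IsGeometric G 𝒞) (hC : C ∈ 𝒞) (hu : u ∈ C) (hy : y ∈ C)
    (hxu : G.dist x u = i) (hxy : G.dist x y = i + 1) :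
    {v ∈ C | G.dist x v = i}.ncard ∈ phiValues G i :=
  ⟨C, x, hG.2.1 C hC, distToSet_clique_eq (hG.2.1 C hC).1 hu hy hxu hxy, rfl⟩

theorem phiValues_eq (hG : IsGeometric G 𝒞) (hxy : G.dist x y = i + 1) :
    phiValues G i = {phi G i} := by
  obtain ⟨u, huy, hxu⟩ := exists_adj_dist_eq hxy
  obtain ⟨C, hC, hu, hy⟩ := hG.isEdgeCliquePartition.exists_mem huy
  exact eq_singleton_sInf (phiValues_subsingleton hG.1 (hG.minEigenvalue_neg huy) i)
    (hG.ncard_mem_phiValues hC hu hy hxu hxy)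

theorem ncard_adj_eq_phi_one (hG : IsGeometric G 𝒞) (hphi : phiValues G 1 = {phi G 1})
    (hℓ : ℓ ∈ 𝒞) (hx : x ∉ ℓ) (hy : y ∈ ℓ) (hxy : G.Adj x y) :
    {z ∈ ℓ | G.Adj x z}.ncard = phi G 1 := by
  have hmem : {z ∈ ℓ | G.Adj x z}.ncard ∈ phiValues G 1 :=
    ⟨ℓ, x, hG.2.1 ℓ hℓ, (distToSet_clique_eq_one_iff (hG.2.1 ℓ hℓ).1 hx).2 ⟨y, hy, hxy⟩, by
      simp only [SimpleGraph.dist_eq_one_iff_adj]⟩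
  rwa [hphi] at hmem

theorem isELSGeometry (hG : IsGeometric G 𝒞) (hxy : G.dist x y = 3) (hφ : 2 ≤ phi G 1)
    (hELS : HasELS G 𝒞) : IsELSGeometry G 𝒞 (phi G 1) := by
  obtain ⟨u, huy, hxu⟩ := exists_adj_dist_eq hxy
  obtain ⟨-, -, a, hxa, hua⟩ := dist_eq_two_iff.1 hxu
  obtain ⟨C, hC, hu, ha⟩ := hG.isEdgeCliquePartition.exists_mem hua
  have hclique := (hG.2.1 C hC).1
  have hlt : 2 < G.dist x y := by omega
  have hadj : ∀ {ℓ z w}, ℓ ∈ 𝒞 → z ∉ ℓ → w ∈ ℓ → G.Adj z w → {v ∈ ℓ | G.Adj z v}.ncard = phi G 1 :=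
    hG.ncard_adj_eq_phi_one (hG.phiValues_eq hxu)
  have hxC : x ∉ C := hG.isEdgeCliquePartition.notMem_of_dist_eq_two hC hu (by rwa [G.dist_comm])
  have hyC : y ∉ C := fun hyC => not_adj_of_mem_clique hclique hyC ha hlt hxa
  have hcard := ncard_adj_add_ncard_adj_le hlt (Set.toFinite C)
  rw [hadj hC hxC ha hxa, hadj hC hyC hu huy.symm] at hcard
  exact
    { hG.isEdgeCliquePartition with
      ncard_adj := hadj
      two_le := hφ
      add_two_le_ncard := fun hℓ => by
        rw [hG.ncard_eq hℓ hC]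
        omega
      hasELS := hELS }

theorem tauValues_subsingleton (hG : IsGeometric G 𝒞) (hphi : phiValues G 1 = {phi G 1})
    (hφ : phi G 1 ≠ 0) : (tauValues G 𝒞 2).Subsingleton := by
  obtain ⟨-, b, c, h⟩ := hG.1
  replace h : HasIntersectionArray G b c := h
  have hc : ∀ n ∈ tauValues G 𝒞 2, n * phi G 1 = c 2 := by
    rintro n ⟨x, y, hxy, rfl⟩
    have hadj : ∀ ℓ ∈ lineSet G 𝒞 x y, {z ∈ ℓ | G.Adj y z}.ncard = phi G 1 := fun ℓ hℓ => by
      obtain ⟨hℓ, hx, p, hp, hyp⟩ := (hG.isEdgeCliquePartition.mem_lineSet_iff hxy).1 hℓ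
      exact hG.ncard_adj_eq_phi_one hphi hℓ
        (hG.isEdgeCliquePartition.notMem_of_dist_eq_two hℓ hx hxy) hp hyp
    simp only [Nat.reduceEqDiff]
    exact (hG.isEdgeCliquePartition.ncard_commonNeighbors hadj hxy).symm.trans
      (h.ncard_commonNeighbors hxy)
  exact fun n hn n' hn' => mul_right_cancel₀ hφ ((hc n hn).trans (hc n' hn').symm)

end IsGeometric

end GeometricGraph

end GeomDRG

theorem mainTheorem7 {V : Type*} [Fintype V] (G : SimpleGraph V) (𝒞 : Set (Set V))
    (hG : GeomDRG.IsGeometric G 𝒞) (hD : 3 ≤ G.diam)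
    (hφ : 2 ≤ GeomDRG.phi G 1) (hELS : GeomDRG.HasELS G 𝒞) :
    -- the parameters involved are well defined
    (GeomDRG.phiValues G 1 = {GeomDRG.phi G 1} ∧
      GeomDRG.phiValues G 2 = {GeomDRG.phi G 2} ∧
      GeomDRG.tauValues G 𝒞 2 = {GeomDRG.tau G 𝒞 2}) ∧
    ∃ r : ℕ, (r : ℝ) = -GeomDRG.minEigenvalue G ∧
      (∀ x : V, GeomDRG.IsDesign 2 r (GeomDRG.tau G 𝒞 2) 1
        {ℓ ∈ 𝒞 | x ∈ ℓ} {b | ∃ z : V, G.dist x z = 2 ∧ b = GeomDRG.lineSet G 𝒞 x z}) ∧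
      (GeomDRG.tau G 𝒞 2 : ℤ) * ((GeomDRG.tau G 𝒞 2 : ℤ) - 1) + 1 ≤ (r : ℤ) ∧
      (GeomDRG.tau G 𝒞 2 : ℤ) * ((GeomDRG.phi G 1 : ℤ) - 1) + 1 ≤ (GeomDRG.phi G 2 : ℤ) := by
  have := hG.1.1.nonempty
  obtain ⟨x, y', hdiam⟩ := G.exists_dist_eq_diam
  obtain ⟨y, hxy⟩ := GeomDRG.exists_dist_eq_of_le (hD.trans hdiam.ge)
  obtain ⟨u, huy, hxu⟩ := GeomDRG.exists_adj_dist_eq hxy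
  obtain ⟨C, hC, hu, hy⟩ := hG.isEdgeCliquePartition.exists_mem huy
  have h := hG.isELSGeometry hxy hφ hELS
  have hphi1 := hG.phiValues_eq hxu
  have hphi2 := hG.phiValues_eq hxy
  have htau := GeomDRG.eq_singleton_sInf (hG.tauValues_subsingleton hphi1 (by omega))
    (GeomDRG.ncard_lineSet_mem_tauValues hxu)
  have hτ : ∀ x z, G.dist x z = 2 → (GeomDRG.lineSet G 𝒞 x z).ncard = GeomDRG.tau G 𝒞 2 :=
    fun x z hxz => htau.subset (GeomDRG.ncard_lineSet_mem_tauValues hxz)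
  have hr := hG.ncard_lines_eq huy
  have hdesign := h.isDesign hxu (fun z => Nat.cast_injective ((hr z).trans (hr u).symm)) hτ
  have hCu : C ∉ GeomDRG.lineSet G 𝒞 u x := fun hCu => by
    have := GeomDRG.distToSet_clique_eq (h.isClique hC) hu hy hxu hxy
    exact absurd (hCu.2.2.symm.trans this) (by decide)
  have hr_bound := (hdesign u).mul_pred_add_one_le ⟨x, by rwa [G.dist_comm], rfl⟩ ⟨hC, hu⟩ hCu
  have hφ_bound := h.ncard_lineSet_mul_pred_add_one_le hC hu hy (by omega) hxu
  have hτ_pos := (hdesign u).1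
  rw [hτ x u hxu, hphi2.subset (hG.ncard_mem_phiValues hC hu hy hxu hxy)] at hφ_bound
  zify [show 1 ≤ GeomDRG.tau G 𝒞 2 by omega] at hr_bound
  zify [show 1 ≤ GeomDRG.phi G 1 by omega] at hφ_bound
  exact ⟨⟨hphi1, hphi2, htau⟩, _, hr u, hdesign, hr_bound, hφ_bound⟩
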